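/- Let $G=(V,E)$ be a finite simple graph and $\omega$ an acyclic orientation of $G$. Write $P(G,\omega)$ for the poset on $V$ in which $i\le j$ iff $\omega$ has a directed path from $i$ to $j$ (possibly of length $0$), and $[\omega]$ for the class of $\omega$ under the equivalence relation on acyclic orientations of $G$ generated by converting a source into a sink (reversing all edges at it). A toric chamber of $G$ is a connected component of $\{x\in\mathbb{R}^V/\mathbb{Z}^V : x_i\neq x_j \text{ for all } \{i,j\}\in E\}$. A toric poset over $V$ is a subset $P$ of $\mathbb{R}^V/\mathbb{Z}^V$ that is a toric chamber of some graph on $V$. The toric poset $P(G,[\omega])$ is the toric chamber of $G$ whose points $x$ determine orientations in $[\omega]$, where $x$ directs an edge $\{i,j\}$ as $i\to j$ iff $x_i \bmod 1 < x_j \bmod 1$ (representatives in $[0,1)$). For a toric poset $P$ and a partition $\pi$ of $V$ let $D^{\mathrm{tor}}_\pi=\{x\in\mathbb{R}^V/\mathbb{Z}^V : x_i=x_j \text{ whenever } i,j \text{ lie in the same block of } \pi\}$, and let the closure of $\pi$ with respect to $P$ be the coarsest partition $\bar\pi$ coarsening $\pi$ with $\overline{P}\cap D^{\mathrm{tor}}_{\bar\pi}=\overline{P}\cap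 D^{\mathrm{tor}}_\pi$; the dimension of $\overline{P}\cap D^{\mathrm{tor}}_\pi$ is defined to be $\dim\{x\in\mathbb{R}^V : x_i=x_j \text{ whenever } i,j \text{ lie in the same block of } \bar\pi\}$. The partition $\pi$ is closed with respect to $P$ if $\bar\pi=\pi$. A subset $I\subseteq V$ is a toric filter (equivalently, a toric order ideal) of $P$ if the partition $\pi$ of $V$ whose blocks are the nonempty sets among $I$ and $V\setminus I$ is closed with respect to $P$ and $\overline{P}\cap D^{\mathrm{tor}}_\pi$ has dimension at most $2$. A total toric extension of $P$ is a toric chamber $P'\subseteq P$ of the complete graph on $V$; its cyclic order is the class, under cyclic rotation, of the list of all elements of $V$ in increasing order of their coordinates $x_i \bmod 1\in[0,1)$, which is the same for all $x\in P'$. Then for every subset $I\subseteq V$ the following are equivalent: 1. $I$ is a toric filter of $P(G,[\omega])$; 2. $I$ is an order ideal (down-closed subset) of $P(G,\omega')$ for some $\omega'\in[\omega]$; 3. $I$ is a filter (up-closed subset) of $P(G,\omega'')$ for some $\omega''\in[\omega]$; 4. there is a total toric extension of $P(G,[\omega])$ in whose cyclic order the elements of $I$ appear consecutively, i.e. some list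 in the cyclic class has exactly the elements of $I$ as an initial segment. -/

import Mathlib

/-- An acyclic orientation of a simple graph `G`: `arrow i j` means that the edge `{i, j}` is
directed `i → j`. Acyclicity excludes, in particular, that an edge is directed both ways. -/
@[ext]
structure AcyclicOrientation {V : Type*} (G : SimpleGraph V) where
  arrow : V → V → Prop
  adj_iff : ∀ i j, G.Adj i j ↔ arrow i j ∨ arrow j i
  acyclic : ∀ i, ¬ Relation.TransGen arrow i i

namespace AcyclicOrientation

variable {V : Type*} {G : SimpleGraph V}

/-- The poset `P(G, ω)` on `V`: `i ≤ j` iff there is a directed path (possibly of length zero)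
from `i` to `j`. -/
@[reducible]
def poset (ω : AcyclicOrientation G) : PartialOrder V where
  le := Relation.ReflTransGen ω.arrow
  le_refl _ := Relation.ReflTransGen.refl
  le_trans _ _ _ h₁ h₂ := h₁.trans h₂
  le_antisymm a b h₁ h₂ := by
    rcases Relation.reflTransGen_iff_eq_or_transGen.1 h₁ with h | h
    · exact h.symm
    · exact absurd (h.trans_left h₂) (ω.acyclic a)

/-- `I` is an order ideal (down-closed subset) of `P(G, ω)`. -/
def IsOrderIdeal (ω : AcyclicOrientation G) (I : Set V) : Prop :=
  @IsLowerSet V ω.poset.toLE I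

/-- `I` is a filter (up-closed subset) of `P(G, ω)`. -/
def IsOrderFilter (ω : AcyclicOrientation G) (I : Set V) : Prop :=
  @IsUpperSet V ω.poset.toLE I

/-- `ω'` is obtained from `ω` by converting a source `v` into a sink: all edges at `v` are
reversed, all other edges keep their direction. -/
def IsFlip (ω ω' : AcyclicOrientation G) : Prop :=
  ∃ v : V, (∀ u, ¬ ω.arrow u v) ∧
    ∀ i j, ω'.arrow i j ↔
      ((i ≠ v ∧ j ≠ v) ∧ ω.arrow i j) ∨ ((i = v ∨ j = v) ∧ ω.arrow j i)

/-- Toric equivalence `ω ≡ ω'`: the equivalence relation generated by source-to-sink flips. -/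
def ToricEquiv (ω ω' : AcyclicOrientation G) : Prop :=
  Relation.EqvGen IsFlip ω ω'

/-- The toric equivalence class `[ω]`. -/
def toricClass (ω : AcyclicOrientation G) : Set (AcyclicOrientation G) :=
  {ω' | ToricEquiv ω ω'}

end AcyclicOrientation

/-- The torus `ℝ^V / ℤ^V = (ℝ / ℤ)^V`, with its product topology. -/
abbrev Torus (V : Type*) : Type _ := V → UnitAddCircle

namespace Torus

variable {V : Type*}

/-- The representative in `[0, 1)` of the coordinate `x_i` of a point of the torus. -/
noncomputable def modOne (x : Torus V) (i : V) : ℝ :=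
  (AddCircle.equivIco (1 : ℝ) 0 (x i) : ℝ)

/-- The complement in the torus of the toric graphic arrangement of `G`, that is of the union of
the toric hyperplanes `{x | x_i = x_j mod 1}` over the edges `{i, j}` of `G`. -/
def arrangementCompl (G : SimpleGraph V) : Set (Torus V) :=
  {x | ∀ i j, G.Adj i j → x i ≠ x j}

/-- The toric chambers of `G`: the connected components of the complement of the toric graphic
arrangement. -/
def chambers (G : SimpleGraph V) : Set (Set (Torus V)) :=
  {c | ∃ x ∈ arrangementCompl G, c = connectedComponentIn (arrangementCompl G) x}

/-- The acyclic orientation of `G` determined by a point `x` off the toric arrangement: the edge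
`{i, j}` is directed `i → j` iff `x_i mod 1 < x_j mod 1`. -/
noncomputable def orientation (G : SimpleGraph V) (x : Torus V) (hx : x ∈ arrangementCompl G) :
    AcyclicOrientation G where
  arrow i j := G.Adj i j ∧ modOne x i < modOne x j
  adj_iff i j := by
    constructor
    · intro h
      have hne : modOne x i ≠ modOne x j := fun he =>
        hx i j h ((AddCircle.equivIco (1 : ℝ) 0).injective (Subtype.ext he))
      rcases lt_or_gt_of_ne hne with h' | h'
      · exact Or.inl ⟨h, h'⟩
      · exact Or.inr ⟨h.symm, h'⟩
    · rintro (h | h)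
      · exact h.1
      · exact h.1.symm
  acyclic i h := by
    have key : ∀ a b, Relation.TransGen
        (fun i j => G.Adj i j ∧ modOne x i < modOne x j) a b → modOne x a < modOne x b := by
      intro a b hab
      induction hab with
      | single h => exact h.2
      | tail _ h ih => exact ih.trans h.2
    exact lt_irrefl _ (key i i h)

/-- The set `D_π` in the torus: the coordinates are equal within each block of the partition
`π`. -/
def flat (π : Setoid V) : Set (Torus V) :=
  {x | ∀ i j, π i j → x i = x j}

/-- The central preimage in `ℝ^V` of `Torus.flat π`. -/
def centralFlat (π : Setoid V) : Submodule ℝ (V → ℝ) where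
  carrier := {x | ∀ i j, π i j → x i = x j}
  zero_mem' _ _ _ := rfl
  add_mem' ha hb i j h := congrArg₂ (· + ·) (ha i j h) (hb i j h)
  smul_mem' c _ ha i j h := congrArg (c * ·) (ha i j h)

end Torus

/-- A toric poset over `V`: a subset of the torus that is a toric chamber of at least one graph on
`V`. -/
structure ToricPoset (V : Type*) where
  chamber : Set (Torus V)
  exists_graph : ∃ G : SimpleGraph V, chamber ∈ Torus.chambers G

namespace ToricPoset

variable {V : Type*}

/-- `P = P(G, [ω])`: the toric poset `P` is a toric chamber of `G`, and the map sending a chamber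
to the toric equivalence class of the orientations determined by its points sends it to `[ω]`. -/
def IsToricPosetOf (P : ToricPoset V) (G : SimpleGraph V) (ω : AcyclicOrientation G) : Prop :=
  P.chamber ∈ Torus.chambers G ∧
    ∃ (x : Torus V) (hx : x ∈ Torus.arrangementCompl G),
      x ∈ P.chamber ∧ Torus.orientation G x hx ∈ ω.toricClass

/-- The intersection of the closed toric chamber of `P` with the flat of the partition `π`. -/
def closedFace (P : ToricPoset V) (π : Setoid V) : Set (Torus V) :=
  closure P.chamber ∩ Torus.flat π

/-- The closure of the partition `π` with respect to `P`: the join, in the lattice of partitions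
(ordered by coarsening), of all coarsenings `σ` of `π` with the same `closedFace` as `π`. -/
def closurePartition (P : ToricPoset V) (π : Setoid V) : Setoid V :=
  sSup {σ | π ≤ σ ∧ P.closedFace σ = P.closedFace π}

/-- The partition `π` is closed with respect to `P`. -/
def IsClosedPartition (P : ToricPoset V) (π : Setoid V) : Prop :=
  P.closurePartition π = π

/-- The dimension of `closedFace P π`: the dimension of the central preimage of the flat of the
closure of `π`. -/
noncomputable def faceDim (P : ToricPoset V) (π : Setoid V) : ℕ :=
  Module.finrank ℝ (Torus.centralFlat (P.closurePartition π))

/-- `I` is a toric filter (equivalently, toric order ideal) of `P`: the partition of `V` into the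
nonempty sets among `I` and `V \ I` is closed with respect to `P`, and its flat meets the closed
toric chamber in dimension at most two. -/
def IsToricFilter (P : ToricPoset V) (I : Set V) : Prop :=
  ∃ π : Setoid V, (∀ i j, π i j ↔ (i ∈ I ↔ j ∈ I)) ∧ P.IsClosedPartition π ∧ P.faceDim π ≤ 2

/-- `P'` is a total toric order: its chamber is a chamber for the complete graph. -/
def IsTotal (P' : ToricPoset V) : Prop :=
  P'.chamber ∈ Torus.chambers (⊤ : SimpleGraph V)

/-- `P'` is a total toric extension of `P`. -/
def IsTotalExtension (P' P : ToricPoset V) : Prop :=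
  P'.IsTotal ∧ P'.chamber ⊆ P.chamber

/-- The cyclic equivalence class `w` of lists is the cyclic order on `V` given by the total toric
order `P'`: for every point `x` of the chamber, some list in the class `w` consists of all elements
of `V` in strictly increasing order of their coordinates modulo one. -/
def HasCyclicOrder (P' : ToricPoset V) (w : Cycle V) : Prop :=
  ∀ x ∈ P'.chamber, ∃ l : List V, (l : Cycle V) = w ∧ (∀ v, v ∈ l) ∧
    l.Pairwise (fun i j => Torus.modOne x i < Torus.modOne x j)

end ToricPoset

/-- The elements of `I` appear consecutively in the cyclic order `w`: some list in the class `w`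
has exactly the elements of `I` in an initial segment. -/
def Cycle.IsConsecutive {V : Type*} (w : Cycle V) (I : Set V) : Prop :=
  ∃ l₁ l₂ : List V, ((l₁ ++ l₂ : List V) : Cycle V) = w ∧
    (∀ v ∈ l₁, v ∈ I) ∧ (∀ v ∈ l₂, v ∉ I)

/-!
Let `P = P(G, [ω])`. Rotating the torus along the diagonal by `-r` moves the coordinates below `r`
past the others; these coordinates form an order ideal of the orientation determined by the point,
and the effect on that orientation is to reverse the edges leaving the ideal, which amounts to
flipping its elements one at a time as sources. Conversely every flip arises in this way. Hence the
chamber `P` is the union of the connected cells cut out by the orientations in `[ω]`, and it is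
stable under rotation.

Consequently `I` is an ideal for some orientation in `[ω]` as soon as the coordinates in `I` precede
the others at some point of `P`, and then rotating past `I` makes it a filter. A point of a total
extension can be rotated to any list in its cyclic order, in particular to one starting with `I`. If
`I` is a toric filter, the closure of `P` contains a point with one value on `I` and another one
off `I`; after a rotation both values are nonzero, and at nearby points of `P` the coordinates in
`I` precede the others or conversely. In the other direction, an ideal `I` of an orientation in
`[ω]` gives points of `P` with distinct coordinates, those in `I` being the smallest, and the point
with coordinates `0` on `I` and `1/2` off `I` lies in the closure of `P`.
-/

theorem exists_strictMono_injective_mem_Ioo (α : Type*) [PartialOrder α] [Countable α] :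
    ∃ g : α → ℝ, StrictMono g ∧ Function.Injective g ∧ ∀ a, g a ∈ Set.Ioo (0 : ℝ) 1 := by
  have : Countable (LinearExtension α) := ‹Countable α›
  have : Nontrivial (Set.Ioo (0 : ℝ) 1) := (Set.Ioo_infinite one_pos).nontrivial.coe_sort
  obtain ⟨e⟩ := Order.embedding_from_countable_to_dense (LinearExtension α) (Set.Ioo (0 : ℝ) 1)
  have hinj : Function.Injective fun a : α => (e (toLinearExtension a) : ℝ) :=
    Subtype.val_injective.comp e.injective
  have hmono : Monotone fun a : α => (e (toLinearExtension a) : ℝ) :=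
    (Subtype.mono_coe _).comp (e.monotone.comp toLinearExtension.monotone)
  exact ⟨_, hmono.strictMono_of_injective hinj, hinj, fun a => (e (toLinearExtension a)).2⟩

theorem exists_list_pairwise_lt {α β : Type*} [LinearOrder β] {f : α → β}
    (hf : Function.Injective f) {S : Set α} (hS : S.Finite) :
    ∃ l : List α, (∀ a, a ∈ l ↔ a ∈ S) ∧ l.Pairwise (f · < f ·) := by
  let _ : LinearOrder α := LinearOrder.lift' f hf
  exact ⟨hS.toFinset.sort, by simp, (Finset.sortedLT_sort _).pairwise⟩

theorem exists_append_of_pairwise_lt {α β : Type*} [LinearOrder β] {f : α → β} {l : List α}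
    (hl : l.Pairwise (f · < f ·)) (r : β) :
    ∃ s t, l = s ++ t ∧ (∀ a ∈ s, f a < r) ∧ ∀ a ∈ t, r ≤ f a := by
  induction l with
  | nil => exact ⟨[], [], by simp⟩
  | cons a l ih =>
    obtain ⟨ha, hl⟩ := List.pairwise_cons.1 hl
    rcases lt_or_ge (f a) r with har | har
    · obtain ⟨s, t, rfl, hs, ht⟩ := ih hl
      exact ⟨a :: s, t, rfl, List.forall_mem_cons.2 ⟨har, hs⟩, ht⟩
    · exact ⟨[], a :: l, rfl, by simp,
        List.forall_mem_cons.2 ⟨har, fun b hb => har.trans (ha b hb).le⟩⟩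

namespace AcyclicOrientation

variable {V : Type*} {G : SimpleGraph V} {ω ω' ω'' : AcyclicOrientation G} {I : Set V} {i j : V}

theorem arrow_asymm (h : ω.arrow i j) : ¬ ω.arrow j i :=
  fun h' => ω.acyclic i (.tail (.single h) h')

theorem arrow_irrefl (i : V) : ¬ ω.arrow i i :=
  fun h => ω.acyclic i (.single h)

theorem isOrderIdeal_iff : ω.IsOrderIdeal I ↔ ∀ i j, ω.arrow i j → j ∈ I → i ∈ I := by
  refine ⟨fun h i j hij => h (Relation.ReflTransGen.single hij), fun h b a hab hb => ?_⟩
  induction (hab : Relation.ReflTransGen ω.arrow a b) with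
  | refl => exact hb
  | tail _ hcd ih => exact ih (h _ _ hcd hb)

theorem isOrderIdeal_compl : ω.IsOrderIdeal Iᶜ ↔ ω.IsOrderFilter I :=
  @isLowerSet_compl V ω.poset.toLE I

theorem isOrderFilter_compl : ω.IsOrderFilter Iᶜ ↔ ω.IsOrderIdeal I :=
  @isUpperSet_compl V ω.poset.toLE I

theorem isOrderFilter_iff : ω.IsOrderFilter I ↔ ∀ i j, ω.arrow i j → i ∈ I → j ∈ I := by
  rw [← isOrderIdeal_compl, isOrderIdeal_iff]
  exact forall₃_congr fun i j _ => not_imp_not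

theorem eq_of_arrow_imp (h : ∀ i j, ω.arrow i j → ω'.arrow i j) : ω = ω' := by
  ext i j
  refine ⟨h i j, fun hij => ?_⟩
  exact ((ω.adj_iff i j).1 ((ω'.adj_iff i j).2 (.inl hij))).resolve_right
    fun hji => arrow_asymm hij (h j i hji)

theorem ToricEquiv.refl (ω : AcyclicOrientation G) : ω.ToricEquiv ω :=
  Relation.EqvGen.refl ω

theorem ToricEquiv.symm (h : ω.ToricEquiv ω') : ω'.ToricEquiv ω :=
  Relation.EqvGen.symm _ _ h

theorem ToricEquiv.trans (h : ω.ToricEquiv ω') (h' : ω'.ToricEquiv ω'') : ω.ToricEquiv ω'' :=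
  Relation.EqvGen.trans _ _ _ h h'

theorem ToricEquiv.toricClass_eq (h : ω.ToricEquiv ω') : ω.toricClass = ω'.toricClass :=
  Set.ext fun _ => ⟨h.symm.trans, h.trans⟩

/-- The orientation obtained from `ω` by reversing all edges between the order ideal `I` and its
complement; for `I = {v}` this is the flip of the source `v`. -/
def flipAcross (ω : AcyclicOrientation G) (I : Set V) (hI : ω.IsOrderIdeal I) :
    AcyclicOrientation G where
  arrow i j := ((i ∈ I ↔ j ∈ I) ∧ ω.arrow i j) ∨ (¬ (i ∈ I ↔ j ∈ I) ∧ ω.arrow j i)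
  adj_iff i j := by rw [ω.adj_iff]; tauto
  acyclic i h := by
    -- A directed path cannot leave `I`, so a cycle would never cross between `I` and `Iᶜ`.
    have path_of_mem_iff : ∀ a b, Relation.TransGen (fun i j => ((i ∈ I ↔ j ∈ I) ∧ ω.arrow i j) ∨
        (¬ (i ∈ I ↔ j ∈ I) ∧ ω.arrow j i)) a b →
        (a ∈ I → b ∈ I) ∧ ((a ∈ I ↔ b ∈ I) → Relation.TransGen ω.arrow a b) := by
      intro a b hab
      induction hab with
      | @single c h =>
        have := isOrderIdeal_iff.1 hI c a
        exact ⟨by tauto, fun _ => .single (by tauto)⟩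
      | @tail b c _ h ih =>
        have := isOrderIdeal_iff.1 hI c b
        exact ⟨by tauto, fun _ => (ih.2 (by tauto)).tail (by tauto)⟩
    exact ω.acyclic i ((path_of_mem_iff i i h).2 Iff.rfl)

theorem flipAcross_arrow (hI : ω.IsOrderIdeal I) : (ω.flipAcross I hI).arrow i j ↔
    ((i ∈ I ↔ j ∈ I) ∧ ω.arrow i j) ∨ (¬ (i ∈ I ↔ j ∈ I) ∧ ω.arrow j i) :=
  Iff.rfl

theorem isOrderFilter_flipAcross (hI : ω.IsOrderIdeal I) :
    (ω.flipAcross I hI).IsOrderFilter I := by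
  refine isOrderFilter_iff.2 fun i j hij => ?_
  have := isOrderIdeal_iff.1 hI j i
  rw [flipAcross_arrow] at hij
  tauto

theorem isOrderIdeal_singleton {v : V} : ω.IsOrderIdeal {v} ↔ ∀ u, ¬ ω.arrow u v := by
  refine isOrderIdeal_iff.trans ⟨fun h u huv => ?_, ?_⟩
  · obtain rfl : u = v := h u v huv rfl
    exact arrow_irrefl u huv
  · rintro h u _ huv rfl
    exact absurd huv (h u)

theorem isFlip_iff :
    ω.IsFlip ω' ↔ ∃ (v : V) (hv : ω.IsOrderIdeal {v}), ω.flipAcross {v} hv = ω' := by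
  refine exists_congr fun v => ?_
  rw [← isOrderIdeal_singleton, ← exists_prop]
  refine exists_congr fun hv => ?_
  have flip_arrow (i j : V) : (ω.flipAcross {v} hv).arrow i j ↔
      ((i ≠ v ∧ j ≠ v) ∧ ω.arrow i j) ∨ ((i = v ∨ j = v) ∧ ω.arrow j i) := by
    have : ω.arrow i j → i ≠ j := by rintro h rfl; exact arrow_irrefl i h
    have : ω.arrow j i → i ≠ j := by rintro h rfl; exact arrow_irrefl i h
    rw [flipAcross_arrow, Set.mem_singleton_iff, Set.mem_singleton_iff]
    grind
  constructor
  · intro h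
    exact eq_of_arrow_imp fun i j hij => (h i j).2 ((flip_arrow i j).1 hij)
  · rintro rfl
    exact flip_arrow

theorem isFlip_flipAcross_of_maximal {v : V} (hI : ω.IsOrderIdeal I)
    (hJ : ω.IsOrderIdeal (I \ {v})) (hv : v ∈ I) (hmax : ∀ u ∈ I, ¬ ω.arrow v u) :
    (ω.flipAcross (I \ {v}) hJ).IsFlip (ω.flipAcross I hI) := by
  have hv' : (ω.flipAcross (I \ {v}) hJ).IsOrderIdeal {v} := by
    refine isOrderIdeal_singleton.2 fun u => ?_
    have := isOrderIdeal_iff.1 hI u v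
    have := hmax u
    have := ω.arrow_irrefl v
    rw [flipAcross_arrow]
    grind
  refine isFlip_iff.2 ⟨v, hv', eq_of_arrow_imp fun i j => ?_⟩
  simp only [flipAcross_arrow]
  grind

theorem toricEquiv_flipAcross [Finite V] (hI : ω.IsOrderIdeal I) :
    ω.ToricEquiv (ω.flipAcross I hI) := by
  induction hn : I.ncard generalizing I with
  | zero =>
    obtain rfl : I = ∅ := (Set.ncard_eq_zero I.toFinite).1 hn
    have h_empty : ω = ω.flipAcross ∅ hI := eq_of_arrow_imp fun i j hij => by
      simpa only [flipAcross_arrow, Set.mem_empty_iff_false, iff_self, true_and, not_true,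
        false_and, or_false] using hij
    exact h_empty ▸ .refl ω
  | succ n ih =>
    obtain ⟨v, hv, hmax⟩ : ∃ v ∈ I, ∀ u ∈ I, ¬ ω.arrow v u := by
      let _ := ω.poset
      obtain ⟨v, hv⟩ := I.toFinite.exists_maximal (Set.nonempty_of_ncard_ne_zero (by omega))
      refine ⟨v, hv.1, fun u hu hvu => ?_⟩
      have hle : v ≤ u := Relation.ReflTransGen.single hvu
      obtain rfl := hle.antisymm (hv.2 hu hle)
      exact arrow_irrefl v hvu
    have hJ : ω.IsOrderIdeal (I \ {v}) := isOrderIdeal_iff.2 fun i j hij hj =>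
      ⟨isOrderIdeal_iff.1 hI i j hij hj.1, fun hiv => hmax j hj.1 (hiv ▸ hij)⟩
    exact (ih hJ (by rw [Set.ncard_sdiff_singleton_of_mem hv, hn, Nat.add_sub_cancel])).trans
      (.rel _ _ (isFlip_flipAcross_of_maximal hI hJ hv hmax))

theorem exists_isOrderIdeal_iff_exists_isOrderFilter [Finite V] :
    (∃ ω' ∈ ω.toricClass, ω'.IsOrderIdeal I) ↔ ∃ ω' ∈ ω.toricClass, ω'.IsOrderFilter I := by
  constructor
  · rintro ⟨ω', hω, hI⟩
    exact ⟨_, hω.trans (toricEquiv_flipAcross hI), isOrderFilter_flipAcross hI⟩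
  · rintro ⟨ω', hω, hI⟩
    have hI' := isOrderIdeal_compl.2 hI
    exact ⟨_, hω.trans (toricEquiv_flipAcross hI'),
      isOrderFilter_compl.1 (isOrderFilter_flipAcross hI')⟩

/-- The half-open order polytope of `ω`: the labellings of the vertices by representatives in
`[0, 1)` that increase strictly along every arrow. -/
def labellings (ω : AcyclicOrientation G) : Set (V → ℝ) :=
  {f | (∀ i, f i ∈ Set.Ico (0 : ℝ) 1) ∧ ∀ i j, ω.arrow i j → f i < f j}

theorem openSegment_subset_labellings {f g : V → ℝ} (hf : ∀ i, f i ∈ Set.Ico (0 : ℝ) 1)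
    (hf' : ∀ i j, ω.arrow i j → f i ≤ f j) (hg : g ∈ ω.labellings) :
    openSegment ℝ f g ⊆ ω.labellings := by
  rintro _ ⟨a, b, ha, hb, hab, rfl⟩
  refine ⟨fun i => convex_Ico 0 1 (hf i) (hg.1 i) ha.le hb.le hab, fun i j hij => ?_⟩
  exact add_lt_add_of_le_of_lt (mul_le_mul_of_nonneg_left (hf' i j hij) ha.le)
    (mul_lt_mul_of_pos_left (hg.2 i j hij) hb)

theorem convex_labellings (ω : AcyclicOrientation G) : Convex ℝ ω.labellings :=
  convex_iff_openSegment_subset.2 fun _ hf _ hg =>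
    openSegment_subset_labellings hf.1 (fun i j hij => (hf.2 i j hij).le) hg

theorem exists_mem_labellings_lt_half_iff [Countable V] (hI : ω.IsOrderIdeal I) :
    ∃ f ∈ ω.labellings, Function.Injective f ∧ ∀ i, f i < 1 / 2 ↔ i ∈ I := by
  classical
  let _ := ω.poset
  obtain ⟨g, hmono, hinj, hg⟩ := exists_strictMono_injective_mem_Ioo V
  have g_lt (i j : V) (hij : ω.arrow i j) : g i < g j :=
    hmono ((show i ≤ j from .single hij).lt_of_ne fun h => arrow_irrefl j (h ▸ hij))
  let f (i : V) : ℝ := if i ∈ I then g i / 2 else (g i + 1) / 2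
  have f_lt_half (i : V) : f i < 1 / 2 ↔ i ∈ I := by
    have := hg i
    by_cases hi : i ∈ I <;> simp only [f, hi, if_true, if_false, iff_true, iff_false] <;>
      linarith [this.1, this.2]
  refine ⟨f, ⟨fun i => ?_, fun i j hij => ?_⟩, fun i j hij => ?_, f_lt_half⟩
  · have := hg i
    dsimp only [f]
    split_ifs <;> constructor <;> linarith [this.1, this.2]
  · have := isOrderIdeal_iff.1 hI i j hij
    have := g_lt i j hij
    have := (hg i).2
    have := (hg j).1
    grind
  · have hI : i ∈ I ↔ j ∈ I := by rw [← f_lt_half i, ← f_lt_half j, hij]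
    have : g i = g j := by grind
    exact hinj this

theorem labellings_nonempty [Countable V] (ω : AcyclicOrientation G) : ω.labellings.Nonempty := by
  obtain ⟨f, hf, -⟩ := exists_mem_labellings_lt_half_iff (ω := ω) (I := ∅)
    (isOrderIdeal_iff.2 fun _ _ _ => False.elim)
  exact ⟨f, hf⟩

end AcyclicOrientation

namespace Torus

open scoped Topology

variable {V : Type*} {G : SimpleGraph V} {x : Torus V} {i j : V}

theorem modOne_mem_Ico (x : Torus V) (i : V) : modOne x i ∈ Set.Ico (0 : ℝ) 1 := by
  simpa only [zero_add] using! (AddCircle.equivIco (1 : ℝ) 0 (x i)).2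

theorem coe_modOne (x : Torus V) (i : V) : (modOne x i : UnitAddCircle) = x i :=
  AddCircle.coe_equivIco

theorem modOne_inj : modOne x i = modOne x j ↔ x i = x j :=
  Subtype.val_injective.eq_iff.trans (AddCircle.equivIco (1 : ℝ) 0).injective.eq_iff

theorem modOne_eq_of_coe_eq {r : ℝ} (hr : r ∈ Set.Ico (0 : ℝ) 1) (h : (r : UnitAddCircle) = x i) :
    modOne x i = r := by
  rw [modOne, ← h, AddCircle.equivIco_coe_eq (by rwa [zero_add])]

theorem continuousAt_modOne (h : x i ≠ 0) : ContinuousAt (fun y : Torus V => modOne y i) x := by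
  have h_equiv : ContinuousAt (AddCircle.equivIco (1 : ℝ) 0) (x i) :=
    AddCircle.continuousAt_equivIco 1 0 (by simpa only [AddCircle.coe_zero] using h)
  exact continuousAt_subtype_val.comp
    (ContinuousAt.comp (f := fun y : Torus V => y i) h_equiv (continuous_apply i).continuousAt)

theorem eventually_modOne_lt_of_lt [Finite V] (hx : ∀ i, x i ≠ 0) :
    ∀ᶠ y in 𝓝 x, ∀ i j, modOne x i < modOne x j → modOne y i < modOne y j := by
  refine Filter.eventually_all.2 fun i => Filter.eventually_all.2 fun j => ?_
  exact Filter.eventually_imp_distrib_left.2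
    ((continuousAt_modOne (hx i)).eventually_lt (continuousAt_modOne (hx j)))

/-- The projection `ℝ^V → ℝ^V / ℤ^V`. -/
def ofReal (f : V → ℝ) : Torus V := fun i => (f i : UnitAddCircle)

theorem continuous_ofReal : Continuous (ofReal : (V → ℝ) → Torus V) :=
  continuous_pi fun i => (AddCircle.continuous_mk' 1).comp (continuous_apply i)

theorem modOne_ofReal {f : V → ℝ} (hf : f i ∈ Set.Ico (0 : ℝ) 1) : modOne (ofReal f) i = f i :=
  modOne_eq_of_coe_eq hf rfl

theorem ofReal_modOne (x : Torus V) : ofReal (modOne x) = x :=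
  funext (coe_modOne x)

theorem exists_coe_neg_eq (c : UnitAddCircle) :
    ∃ r ∈ Set.Icc (0 : ℝ) 1, ((-r : ℝ) : UnitAddCircle) = c :=
  ⟨modOne (fun _ : Unit => -c) (), Set.Ico_subset_Icc_self (modOne_mem_Ico _ _), by
    rw [AddCircle.coe_neg, coe_modOne, neg_neg]⟩

theorem modOne_vadd_of_le {r : ℝ} (hr : 0 ≤ r) (h : r ≤ modOne x i) :
    modOne (((-r : ℝ) : UnitAddCircle) +ᵥ x) i = modOne x i - r := by
  have := (modOne_mem_Ico x i).2
  refine modOne_eq_of_coe_eq ⟨by linarith, by linarith⟩ ?_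
  rw [Pi.vadd_apply, vadd_eq_add, ← coe_modOne x i, ← AddCircle.coe_add, sub_eq_neg_add]

theorem modOne_vadd_of_lt {r : ℝ} (hr : r ≤ 1) (h : modOne x i < r) :
    modOne (((-r : ℝ) : UnitAddCircle) +ᵥ x) i = modOne x i - r + 1 := by
  have := (modOne_mem_Ico x i).1
  refine modOne_eq_of_coe_eq ⟨by linarith, by linarith⟩ ?_
  rw [Pi.vadd_apply, vadd_eq_add, ← coe_modOne x i, AddCircle.coe_add_period, ← AddCircle.coe_add,
    sub_eq_neg_add]

theorem exists_vadd_ne_zero [Finite V] (x : Torus V) :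
    ∃ c : UnitAddCircle, ∀ i, (c +ᵥ x) i ≠ 0 := by
  have : Infinite UnitAddCircle :=
    (AddCircle.equivIco (1 : ℝ) 0).infinite_iff.2 (Set.Ico_infinite (by norm_num)).to_subtype
  obtain ⟨c, hc⟩ := (Set.finite_range fun i => -x i).exists_notMem
  exact ⟨c, fun i h => hc ⟨i, (eq_neg_of_add_eq_zero_left h).symm⟩⟩

theorem vadd_mem_connectedComponentIn (hx : x ∈ arrangementCompl G) (c : UnitAddCircle) :
    c +ᵥ x ∈ connectedComponentIn (arrangementCompl G) x := by
  have h_circle : IsPreconnected (Set.range fun c : UnitAddCircle => c +ᵥ x) :=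
    isPreconnected_range (by fun_prop)
  refine h_circle.subset_connectedComponentIn ⟨0, zero_vadd _ x⟩ ?_ ⟨c, rfl⟩
  rintro _ ⟨c, rfl⟩ i j hij h
  exact hx i j hij (add_left_cancel h)

end Torus

namespace AcyclicOrientation

open Torus
open scoped Topology

variable {V : Type*} {G : SimpleGraph V} {ω ω' : AcyclicOrientation G} {I : Set V}
  {x y : Torus V} {i j : V}

/-- The points of the torus that determine the orientation `ω`. -/
def realizations (ω : AcyclicOrientation G) : Set (Torus V) :=
  {x | ∀ i j, ω.arrow i j → modOne x i < modOne x j}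

theorem arrow_iff_of_mem_realizations (hx : x ∈ ω.realizations) :
    ω.arrow i j ↔ G.Adj i j ∧ modOne x i < modOne x j := by
  refine ⟨fun h => ⟨(ω.adj_iff i j).2 (.inl h), hx i j h⟩, fun ⟨hij, hlt⟩ => ?_⟩
  exact ((ω.adj_iff i j).1 hij).resolve_right fun h => lt_asymm hlt (hx j i h)

theorem eq_of_mem_realizations (hx : x ∈ ω.realizations) (hx' : x ∈ ω'.realizations) : ω = ω' :=
  AcyclicOrientation.ext <| funext₂ fun _ _ => propext <|
    (arrow_iff_of_mem_realizations hx).trans (arrow_iff_of_mem_realizations hx').symm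

theorem mem_realizations_orientation (hx : x ∈ arrangementCompl G) :
    x ∈ (orientation G x hx).realizations :=
  fun _ _ h => h.2

theorem realizations_subset_arrangementCompl (ω : AcyclicOrientation G) :
    ω.realizations ⊆ arrangementCompl G := by
  intro x hx i j hij h
  have h_mod := modOne_inj.2 h
  rcases (ω.adj_iff i j).1 hij with hij | hji
  · exact (hx i j hij).ne h_mod
  · exact (hx j i hji).ne' h_mod

theorem ofReal_mem_realizations {f : V → ℝ} (hf : f ∈ ω.labellings) :
    ofReal f ∈ ω.realizations := fun i j hij => by
  simpa only [modOne_ofReal (hf.1 _)] using hf.2 i j hij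

theorem image_ofReal_labellings (ω : AcyclicOrientation G) :
    ofReal '' ω.labellings = ω.realizations :=
  Set.Subset.antisymm (Set.image_subset_iff.2 fun _ => ofReal_mem_realizations)
    fun x hx => ⟨modOne x, ⟨modOne_mem_Ico x, hx⟩, ofReal_modOne x⟩

theorem realizations_nonempty [Countable V] (ω : AcyclicOrientation G) :
    ω.realizations.Nonempty :=
  ω.image_ofReal_labellings ▸ ω.labellings_nonempty.image ofReal

theorem isPreconnected_realizations (ω : AcyclicOrientation G) :
    IsPreconnected ω.realizations :=
  ω.image_ofReal_labellings ▸
    ω.convex_labellings.isPreconnected.image _ continuous_ofReal.continuousOn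

theorem ofReal_mem_closure_realizations [Countable V] {f : V → ℝ}
    (hf : ∀ i, f i ∈ Set.Ico (0 : ℝ) 1) (hf' : ∀ i j, ω.arrow i j → f i ≤ f j) :
    ofReal f ∈ closure ω.realizations := by
  obtain ⟨g, hg⟩ := ω.labellings_nonempty
  have hf_closure : f ∈ closure ω.labellings :=
    closure_mono (openSegment_subset_labellings hf hf' hg)
      (segment_subset_closure_openSegment (left_mem_segment ℝ f g))
  exact map_mem_closure continuous_ofReal hf_closure fun _ => ofReal_mem_realizations

theorem isOrderIdeal_of_mem_realizations (hx : x ∈ ω.realizations)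
    (hI : ∀ i ∈ I, ∀ j ∉ I, modOne x i ≤ modOne x j) : ω.IsOrderIdeal I :=
  isOrderIdeal_iff.2 fun i j hij hj => by_contra fun hi => (hx i j hij).not_ge (hI j hj i hi)

theorem vadd_mem_realizations_flipAcross (hx : x ∈ ω.realizations) (hI : ω.IsOrderIdeal I) {r : ℝ}
    (hr : r ∈ Set.Icc (0 : ℝ) 1) (hrI : ∀ i, modOne x i < r ↔ i ∈ I) :
    ((-r : ℝ) : UnitAddCircle) +ᵥ x ∈ (ω.flipAcross I hI).realizations := by
  have modOne_of_mem {k : V} (hk : k ∈ I) := modOne_vadd_of_lt hr.2 ((hrI k).2 hk)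
  have modOne_of_notMem {k : V} (hk : k ∉ I) :=
    modOne_vadd_of_le hr.1 (not_lt.1 (mt (hrI k).1 hk))
  rintro i j (⟨hij, h⟩ | ⟨hij, h⟩)
  · have := hx i j h
    by_cases hi : i ∈ I
    · rw [modOne_of_mem hi, modOne_of_mem (hij.1 hi)]
      linarith
    · rw [modOne_of_notMem hi, modOne_of_notMem (mt hij.2 hi)]
      linarith
  · have hj : j ∈ I := by have := isOrderIdeal_iff.1 hI j i h; tauto
    have hi : i ∉ I := by tauto
    rw [modOne_of_mem hj, modOne_of_notMem hi]
    linarith [(modOne_mem_Ico x i).2, (modOne_mem_Ico x j).1]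

theorem exists_vadd_mem_realizations [Finite V] (hx : x ∈ ω.realizations) (c : UnitAddCircle) :
    ∃ ω' ∈ ω.toricClass, c +ᵥ x ∈ ω'.realizations := by
  obtain ⟨r, hr, rfl⟩ := exists_coe_neg_eq c
  have hI : ω.IsOrderIdeal {i | modOne x i < r} :=
    isOrderIdeal_of_mem_realizations hx fun i hi j hj => hi.le.trans (not_lt.1 hj)
  exact ⟨_, toricEquiv_flipAcross hI, vadd_mem_realizations_flipAcross hx hI hr fun _ => Iff.rfl⟩

theorem exists_vadd_mem_realizations_flipAcross [Countable V] (hI : ω.IsOrderIdeal I) :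
    ∃ x ∈ ω.realizations, ∃ c : UnitAddCircle, c +ᵥ x ∈ (ω.flipAcross I hI).realizations := by
  obtain ⟨f, hf, -, hfI⟩ := exists_mem_labellings_lt_half_iff hI
  refine ⟨_, ofReal_mem_realizations hf, _, vadd_mem_realizations_flipAcross
    (ofReal_mem_realizations hf) hI (r := 1 / 2) (by norm_num) fun i => ?_⟩
  rw [modOne_ofReal (hf.1 i), hfI]

/-- Every point has a rotation without zero coordinates, near which the orientation is constant. -/
theorem connectedComponentIn_induction [Finite V] {p : Torus V → Prop}
    (h_vadd : ∀ (c : UnitAddCircle) x, p x → p (c +ᵥ x))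
    (h_realizations : ∀ ω : AcyclicOrientation G, ∀ x ∈ ω.realizations, ∀ y ∈ ω.realizations,
      p x → p y)
    (hx : x ∈ arrangementCompl G) (hy : y ∈ connectedComponentIn (arrangementCompl G) x)
    (hpx : p x) : p y := by
  have p_vadd (c : UnitAddCircle) (z : Torus V) : p (c +ᵥ z) ↔ p z :=
    ⟨fun h => by simpa only [neg_vadd_vadd] using h_vadd (-c) _ h, h_vadd c z⟩
  have p_eventually : ∀ z ∈ arrangementCompl G, ∀ᶠ z' in 𝓝 z, p z ↔ p z' := by
    intro z hz
    obtain ⟨c, hc⟩ := exists_vadd_ne_zero z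
    have hcz : c +ᵥ z ∈ arrangementCompl G :=
      connectedComponentIn_subset _ _ (vadd_mem_connectedComponentIn hz c)
    have h_nhds := (continuous_const_vadd c).continuousAt.eventually (eventually_modOne_lt_of_lt hc)
    filter_upwards [h_nhds] with z' hz'
    have hz'ω : c +ᵥ z' ∈ (orientation G _ hcz).realizations := fun i j hij => hz' i j hij.2
    rw [← p_vadd c z, ← p_vadd c z']
    have hzω := mem_realizations_orientation hcz
    exact ⟨h_realizations _ _ hzω _ hz'ω, h_realizations _ _ hz'ω _ hzω⟩
  exact ((isPreconnected_connectedComponentIn (F := arrangementCompl G) (x := x)).induction₂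
    (fun a b => p a ↔ p b)
    (fun z hz => nhdsWithin_le_nhds (p_eventually z (connectedComponentIn_subset _ _ hz)))
    (fun _ _ _ _ _ _ hab hbc => hab.trans hbc) (fun _ _ _ _ hab => hab.symm)
    (mem_connectedComponentIn hx) hy).1 hpx

theorem connectedComponentIn_eq_of_mem_realizations (hx : x ∈ ω.realizations)
    (hy : y ∈ ω.realizations) :
    connectedComponentIn (arrangementCompl G) x = connectedComponentIn (arrangementCompl G) y :=
  connectedComponentIn_eq <| ω.isPreconnected_realizations.subset_connectedComponentIn hx
    ω.realizations_subset_arrangementCompl hy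

theorem connectedComponentIn_eq_of_toricEquiv [Finite V] (h : ω.ToricEquiv ω')
    (hx : x ∈ ω.realizations) (hy : y ∈ ω'.realizations) :
    connectedComponentIn (arrangementCompl G) x = connectedComponentIn (arrangementCompl G) y := by
  induction h generalizing x y with
  | refl => exact connectedComponentIn_eq_of_mem_realizations hx hy
  | symm _ _ _ ih => exact (ih hy hx).symm
  | trans _ ω₁ _ _ _ ih₁ ih₂ =>
    obtain ⟨z, hz⟩ := ω₁.realizations_nonempty
    exact (ih₁ hx hz).trans (ih₂ hz hy)
  | rel ω _ h =>
    obtain ⟨v, hv, rfl⟩ := isFlip_iff.1 h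
    obtain ⟨z, hz, c, hcz⟩ := exists_vadd_mem_realizations_flipAcross hv
    calc connectedComponentIn (arrangementCompl G) x
        = connectedComponentIn (arrangementCompl G) z :=
          connectedComponentIn_eq_of_mem_realizations hx hz
      _ = connectedComponentIn (arrangementCompl G) (c +ᵥ z) := connectedComponentIn_eq
          (vadd_mem_connectedComponentIn (ω.realizations_subset_arrangementCompl hz) c)
      _ = connectedComponentIn (arrangementCompl G) y :=
          connectedComponentIn_eq_of_mem_realizations hcz hy

theorem connectedComponentIn_eq_biUnion_realizations [Finite V] (hx : x ∈ ω.realizations) :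
    connectedComponentIn (arrangementCompl G) x = ⋃ ω' ∈ ω.toricClass, ω'.realizations := by
  have hxG := ω.realizations_subset_arrangementCompl hx
  refine Set.Subset.antisymm (fun y hy => ?_) (Set.iUnion₂_subset fun ω' hω' y hy => ?_)
  · refine connectedComponentIn_induction (fun c z hz => ?_) (fun α z hz z' hz' hzω => ?_) hxG hy
      (Set.mem_biUnion (ToricEquiv.refl ω) hx)
    · obtain ⟨ω₁, hω₁, hzω₁⟩ := Set.mem_iUnion₂.1 hz
      obtain ⟨ω₂, hω₂, hzω₂⟩ := exists_vadd_mem_realizations hzω₁ c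
      exact Set.mem_biUnion (ToricEquiv.trans hω₁ hω₂) hzω₂
    · obtain ⟨ω₁, hω₁, hzω₁⟩ := Set.mem_iUnion₂.1 hzω
      obtain rfl := eq_of_mem_realizations hz hzω₁
      exact Set.mem_biUnion hω₁ hz'
  · rw [connectedComponentIn_eq_of_toricEquiv hω' hx hy]
    exact mem_connectedComponentIn (ω'.realizations_subset_arrangementCompl hy)

end AcyclicOrientation

namespace Torus

variable {V : Type*} {x y : Torus V} {l l' s t : List V}

/-- `l` lists all elements of `V` in strictly increasing order of their coordinates modulo one.
The cyclic order of a total toric order is the class of such a list. -/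
def IsSortedList (x : Torus V) (l : List V) : Prop :=
  (∀ v, v ∈ l) ∧ l.Pairwise fun i j => modOne x i < modOne x j

theorem IsSortedList.vadd (h : IsSortedList x (s ++ t)) {r : ℝ} (hr : r ∈ Set.Icc (0 : ℝ) 1)
    (hs : ∀ v ∈ s, modOne x v < r) (ht : ∀ v ∈ t, r ≤ modOne x v) :
    IsSortedList (((-r : ℝ) : UnitAddCircle) +ᵥ x) (t ++ s) := by
  obtain ⟨h_mem, h_sorted⟩ := h
  obtain ⟨h_sorted_s, h_sorted_t, -⟩ := List.pairwise_append.1 h_sorted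
  refine ⟨fun v => List.mem_append.2 (List.mem_append.1 (h_mem v)).symm,
    List.pairwise_append.2 ⟨?_, ?_, fun i hi j hj => ?_⟩⟩
  · refine h_sorted_t.imp_of_mem fun hi hj hij => ?_
    rw [modOne_vadd_of_le hr.1 (ht _ hi), modOne_vadd_of_le hr.1 (ht _ hj)]
    linarith
  · refine h_sorted_s.imp_of_mem fun hi hj hij => ?_
    rw [modOne_vadd_of_lt hr.2 (hs _ hi), modOne_vadd_of_lt hr.2 (hs _ hj)]
    linarith
  · rw [modOne_vadd_of_le hr.1 (ht i hi), modOne_vadd_of_lt hr.2 (hs j hj)]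
    linarith [(modOne_mem_Ico x i).2, (modOne_mem_Ico x j).1]

theorem IsSortedList.exists_isRotated_vadd (h : IsSortedList x l) (c : UnitAddCircle) :
    ∃ l', l ~r l' ∧ IsSortedList (c +ᵥ x) l' := by
  obtain ⟨r, hr, rfl⟩ := exists_coe_neg_eq c
  obtain ⟨s, t, rfl, hs, ht⟩ := exists_append_of_pairwise_lt h.2 r
  exact ⟨t ++ s, List.isRotated_append, h.vadd hr hs ht⟩

theorem IsSortedList.exists_vadd_of_isRotated (h : IsSortedList x l) (hl : l ~r l') :
    ∃ c : UnitAddCircle, IsSortedList (c +ᵥ x) l' := by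
  obtain ⟨n, rfl⟩ := hl
  rw [List.rotate_eq_drop_append_take_mod]
  rw [← List.take_append_drop (n % l.length) l] at h
  generalize l.take (n % l.length) = s at h ⊢
  generalize l.drop (n % l.length) = t at h ⊢
  cases t with
  | nil => exact ⟨0, by simpa only [zero_vadd, List.append_nil, List.nil_append] using h⟩
  | cons b t =>
    obtain ⟨-, h_sorted, h_lt⟩ := List.pairwise_append.1 h.2
    refine ⟨_, h.vadd (r := modOne x b) (Set.Ico_subset_Icc_self (modOne_mem_Ico x b))
      (fun v hv => h_lt v hv b List.mem_cons_self) (List.forall_mem_cons.2 ⟨le_rfl, ?_⟩)⟩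
    exact fun v hv => ((List.pairwise_cons.1 h_sorted).1 v hv).le

theorem IsSortedList.exists_isRotated_of_mem_connectedComponentIn [Finite V]
    (h : IsSortedList x l) (hx : x ∈ arrangementCompl (⊤ : SimpleGraph V))
    (hy : y ∈ connectedComponentIn (arrangementCompl (⊤ : SimpleGraph V)) x) :
    ∃ l', l ~r l' ∧ IsSortedList y l' := by
  refine AcyclicOrientation.connectedComponentIn_induction
    (p := fun z => ∃ l', l ~r l' ∧ IsSortedList z l') (fun c z ⟨l₁, hl₁, hz⟩ => ?_)
    (fun ω z hz z' hz' ⟨l₁, hl₁, h_mem, h_sorted⟩ => ⟨l₁, hl₁, h_mem, ?_⟩) hx hy ⟨l, .refl l, h⟩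
  · obtain ⟨l₂, hl₂, hz₂⟩ := hz.exists_isRotated_vadd c
    exact ⟨l₂, hl₁.trans hl₂, hz₂⟩
  · refine h_sorted.imp fun {i j} hij => hz' i j ?_
    exact (AcyclicOrientation.arrow_iff_of_mem_realizations hz).2
      ⟨fun h => hij.ne (congrArg _ h), hij⟩

theorem finrank_centralFlat_ker_le {ι : Type*} [Fintype ι] (f : V → ι) :
    Module.finrank ℝ (centralFlat (Setoid.ker f)) ≤ Fintype.card ι := by
  have h_le : centralFlat (Setoid.ker f) ≤ LinearMap.range (LinearMap.funLeft ℝ ℝ f) := by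
    intro x hx
    have x_factors : Function.FactorsThrough x f := fun i j h => hx i j h
    exact ⟨Function.extend f x 0, x_factors.extend_comp _⟩
  calc Module.finrank ℝ (centralFlat (Setoid.ker f))
      ≤ Module.finrank ℝ (LinearMap.range (LinearMap.funLeft ℝ ℝ f)) := Submodule.finrank_mono h_le
    _ ≤ Module.finrank ℝ (ι → ℝ) := LinearMap.finrank_range_le _
    _ = Fintype.card ι := Module.finrank_fintype_fun_eq_card ℝ

end Torus

namespace ToricPoset

open Torus AcyclicOrientation

variable {V : Type*} {G : SimpleGraph V} {ω ω' : AcyclicOrientation G} {P P' : ToricPoset V}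
  {π : Setoid V} {I : Set V} {x : Torus V} {i j : V}

theorem closurePartition_apply :
    P.closurePartition π i j ↔ ∀ x ∈ P.closedFace π, x i = x j := by
  let σ : Setoid V :=
    { r i j := ∀ x ∈ P.closedFace π, x i = x j
      iseqv := ⟨fun _ _ _ => rfl, fun h x hx => (h x hx).symm,
        fun h h' x hx => (h x hx).trans (h' x hx)⟩ }
  have le_σ : π ≤ σ := fun i j hij x hx => hx.2 i j hij
  have closedFace_σ : P.closedFace σ = P.closedFace π := Set.Subset.antisymm
    (fun x hx => ⟨hx.1, fun i j hij => hx.2 i j (le_σ hij)⟩)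
    (fun x hx => ⟨hx.1, fun i j hij => hij x hx⟩)
  have closure_le_σ : P.closurePartition π ≤ σ :=
    sSup_le fun τ hτ i j hij x hx => (hτ.2 ▸ hx : x ∈ P.closedFace τ).2 i j hij
  have σ_le_closure : σ ≤ P.closurePartition π := le_sSup ⟨le_σ, closedFace_σ⟩
  exact ⟨fun h => closure_le_σ h, fun h => σ_le_closure h⟩

theorem isClosedPartition_iff :
    P.IsClosedPartition π ↔ ∀ i j, ¬ π i j → ∃ x ∈ P.closedFace π, x i ≠ x j := by
  have le_closure : π ≤ P.closurePartition π := le_sSup ⟨le_rfl, rfl⟩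
  refine (le_closure.ge_iff_eq').symm.trans (forall₂_congr fun i j => ?_)
  rw [closurePartition_apply, ← not_imp_not]
  push Not
  rfl

theorem chamber_subset_arrangementCompl (hP : P.chamber ∈ chambers G) :
    P.chamber ⊆ arrangementCompl G := by
  obtain ⟨z, -, hz⟩ := hP
  exact hz ▸ connectedComponentIn_subset _ _

theorem chamber_eq_connectedComponentIn (hP : P.chamber ∈ chambers G) (hx : x ∈ P.chamber) :
    P.chamber = connectedComponentIn (arrangementCompl G) x := by
  obtain ⟨z, -, hz⟩ := hP
  rw [hz] at hx ⊢
  exact connectedComponentIn_eq hx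

theorem IsTotal.hasCyclicOrder [Finite V] (hP : P.IsTotal) (hx : x ∈ P.chamber) {l : List V}
    (hl : IsSortedList x l) : P.HasCyclicOrder l := by
  intro y hy
  rw [chamber_eq_connectedComponentIn hP hx] at hy
  obtain ⟨l', hl', hy'⟩ := hl.exists_isRotated_of_mem_connectedComponentIn
    (chamber_subset_arrangementCompl hP hx) hy
  exact ⟨l', Cycle.coe_eq_coe.2 hl'.symm, hy'⟩

namespace IsToricPosetOf

theorem chamber_eq_biUnion_realizations [Finite V] (hP : P.IsToricPosetOf G ω) :
    P.chamber = ⋃ ω' ∈ ω.toricClass, ω'.realizations := by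
  obtain ⟨h_chamber, x, hx, hxP, hω⟩ := hP
  rw [chamber_eq_connectedComponentIn h_chamber hxP, ToricEquiv.toricClass_eq hω]
  exact connectedComponentIn_eq_biUnion_realizations (mem_realizations_orientation hx)

theorem mem_chamber_iff [Finite V] (hP : P.IsToricPosetOf G ω) :
    x ∈ P.chamber ↔ ∃ ω' ∈ ω.toricClass, x ∈ ω'.realizations := by
  rw [hP.chamber_eq_biUnion_realizations, Set.mem_iUnion₂]
  simp only [exists_prop]

theorem vadd_mem_chamber (hP : P.IsToricPosetOf G ω) (hx : x ∈ P.chamber) (c : UnitAddCircle) :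
    c +ᵥ x ∈ P.chamber := by
  rw [chamber_eq_connectedComponentIn hP.1 hx]
  exact vadd_mem_connectedComponentIn (chamber_subset_arrangementCompl hP.1 hx) c

theorem exists_isOrderIdeal_of_mem_chamber [Finite V] (hP : P.IsToricPosetOf G ω)
    (hx : x ∈ P.chamber) (hI : ∀ i ∈ I, ∀ j ∉ I, modOne x i ≤ modOne x j) :
    ∃ ω' ∈ ω.toricClass, ω'.IsOrderIdeal I := by
  obtain ⟨ω', hω', hxω'⟩ := hP.mem_chamber_iff.1 hx
  exact ⟨ω', hω', isOrderIdeal_of_mem_realizations hxω' hI⟩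

theorem exists_isOrderIdeal_of_mem_closure [Finite V] (hP : P.IsToricPosetOf G ω)
    (hx : x ∈ closure P.chamber) {a b : UnitAddCircle} (hab : a ≠ b) (hxI : ∀ i ∈ I, x i = a)
    (hxI' : ∀ i ∉ I, x i = b) : ∃ ω' ∈ ω.toricClass, ω'.IsOrderIdeal I := by
  -- Away from `0` the order between the two values persists at nearby points of the chamber.
  obtain ⟨c, hc⟩ := exists_vadd_ne_zero x
  have h_nhds := (continuous_const_vadd c).continuousAt.eventually (eventually_modOne_lt_of_lt hc)
  obtain ⟨y, hyP, hy⟩ := ((mem_closure_iff_frequently.1 hx).and_eventually h_nhds).exists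
  have hcy := hP.vadd_mem_chamber hyP c
  let e := AddCircle.equivIco (1 : ℝ) 0
  have modOne_of_mem {i : V} (hi : i ∈ I) : modOne (c +ᵥ x) i = e (c + a) := by
    rw [← hxI i hi]; rfl
  have modOne_of_notMem {i : V} (hi : i ∉ I) : modOne (c +ᵥ x) i = e (c + b) := by
    rw [← hxI' i hi]; rfl
  have e_ne : (e (c + a) : ℝ) ≠ e (c + b) := fun h =>
    hab (add_left_cancel (e.injective (Subtype.ext h)))
  rcases e_ne.lt_or_gt with h_lt | h_gt
  · refine hP.exists_isOrderIdeal_of_mem_chamber hcy fun i hi j hj => (hy i j ?_).le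
    rwa [modOne_of_mem hi, modOne_of_notMem hj]
  · rw [exists_isOrderIdeal_iff_exists_isOrderFilter]
    simp only [← isOrderIdeal_compl]
    refine hP.exists_isOrderIdeal_of_mem_chamber hcy fun i hi j hj => (hy i j ?_).le
    rwa [modOne_of_notMem hi, modOne_of_mem (not_not.1 hj)]

theorem exists_isOrderIdeal_of_isToricFilter [Finite V] (hP : P.IsToricPosetOf G ω)
    (hI : P.IsToricFilter I) : ∃ ω' ∈ ω.toricClass, ω'.IsOrderIdeal I := by
  obtain ⟨π, hπ, h_closed, -⟩ := hI
  by_cases h_trivial : ∀ i j, i ∈ I ↔ j ∈ I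
  · exact ⟨ω, .refl ω, isOrderIdeal_iff.2 fun i j _ => (h_trivial i j).2⟩
  obtain ⟨i, hi, j, hj⟩ : ∃ i ∈ I, ∃ j, j ∉ I := by
    by_contra! h
    exact h_trivial fun i j => ⟨fun hi => h i hi j, fun hj => h j hj i⟩
  obtain ⟨x, ⟨hx, hxπ⟩, hij⟩ := isClosedPartition_iff.1 h_closed i j (by rw [hπ]; tauto)
  exact hP.exists_isOrderIdeal_of_mem_closure hx hij
    (fun k hk => hxπ k i ((hπ k i).2 (iff_of_true hk hi)))
    (fun k hk => hxπ k j ((hπ k j).2 (iff_of_false hk hj)))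

theorem isToricFilter_of_isOrderIdeal [Finite V] (hP : P.IsToricPosetOf G ω)
    (hω : ω' ∈ ω.toricClass) (hI : ω'.IsOrderIdeal I) : P.IsToricFilter I := by
  classical
  have ker_iff (i j : V) : Setoid.ker (· ∈ I) i j ↔ (i ∈ I ↔ j ∈ I) :=
    Setoid.ker_def.trans eq_iff_iff
  let f (i : V) : ℝ := if i ∈ I then 0 else 1 / 2
  have f_mem (i : V) : f i ∈ Set.Ico (0 : ℝ) 1 := by
    dsimp only [f]
    split_ifs <;> norm_num
  have f_eq_iff (i j : V) : f i = f j ↔ (i ∈ I ↔ j ∈ I) := by grind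
  have f_mem_closure : ofReal f ∈ closure P.chamber := by
    rw [hP.chamber_eq_biUnion_realizations]
    refine closure_mono (Set.subset_biUnion_of_mem hω)
      (ofReal_mem_closure_realizations f_mem fun i j hij => ?_)
    have := isOrderIdeal_iff.1 hI i j hij
    grind
  have h_closed : P.IsClosedPartition (Setoid.ker (· ∈ I)) := by
    refine isClosedPartition_iff.2 fun i j hij => ⟨ofReal f, ⟨f_mem_closure, fun k l hkl => ?_⟩, ?_⟩
    · exact congrArg ((↑) : ℝ → UnitAddCircle) ((f_eq_iff k l).2 ((ker_iff k l).1 hkl))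
    · rwa [← modOne_inj.ne, modOne_ofReal (f_mem i), modOne_ofReal (f_mem j), ne_eq, f_eq_iff,
        ← ker_iff]
  refine ⟨_, ker_iff, h_closed, ?_⟩
  rw [faceDim, h_closed]
  exact (finrank_centralFlat_ker_le _).trans_eq Fintype.card_prop

theorem exists_isTotalExtension_of_isOrderIdeal [Finite V] (hP : P.IsToricPosetOf G ω)
    (hω : ω' ∈ ω.toricClass) (hI : ω'.IsOrderIdeal I) :
    ∃ P' : ToricPoset V, P'.IsTotalExtension P ∧
      ∃ w : Cycle V, P'.HasCyclicOrder w ∧ w.IsConsecutive I := by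
  obtain ⟨f, hf, hf_inj, hfI⟩ := exists_mem_labellings_lt_half_iff hI
  have modOne_f (i : V) : modOne (ofReal f) i = f i := modOne_ofReal (hf.1 i)
  have hxP : ofReal f ∈ P.chamber := hP.mem_chamber_iff.2 ⟨ω', hω, ofReal_mem_realizations hf⟩
  have hx : ofReal f ∈ arrangementCompl (⊤ : SimpleGraph V) := fun i j hij => by
    rw [← modOne_inj.ne, modOne_f, modOne_f]
    exact hf_inj.ne hij
  obtain ⟨l₁, hl₁, h_sorted₁⟩ := exists_list_pairwise_lt hf_inj I.toFinite
  obtain ⟨l₂, hl₂, h_sorted₂⟩ := exists_list_pairwise_lt hf_inj Iᶜ.toFinite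
  have h_sorted : IsSortedList (ofReal f) (l₁ ++ l₂) := by
    refine ⟨fun v => ?_, ?_⟩
    · rw [List.mem_append, hl₁, hl₂]
      exact em _
    · simp only [modOne_f]
      refine List.pairwise_append.2 ⟨h_sorted₁, h_sorted₂, fun i hi j hj => ?_⟩
      exact ((hfI i).2 ((hl₁ i).1 hi)).trans_le (not_lt.1 (mt (hfI j).1 ((hl₂ j).1 hj)))
  let P' : ToricPoset V := ⟨connectedComponentIn (arrangementCompl ⊤) (ofReal f), ⊤, _, hx, rfl⟩
  have hP' : P'.IsTotal := ⟨_, hx, rfl⟩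
  have hP'P : P'.chamber ⊆ P.chamber := by
    rw [chamber_eq_connectedComponentIn hP.1 hxP]
    exact connectedComponentIn_mono _ fun y hy i j hij => hy i j hij.ne
  exact ⟨P', ⟨hP', hP'P⟩, _, hP'.hasCyclicOrder (mem_connectedComponentIn hx) h_sorted,
    l₁, l₂, rfl, fun v => (hl₁ v).1, fun v => (hl₂ v).1⟩

theorem exists_isOrderIdeal_of_isTotalExtension [Finite V] (hP : P.IsToricPosetOf G ω)
    (hP' : P'.IsTotalExtension P) {w : Cycle V} (hw : P'.HasCyclicOrder w)
    (hI : w.IsConsecutive I) : ∃ ω' ∈ ω.toricClass, ω'.IsOrderIdeal I := by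
  obtain ⟨l₁, l₂, hlw, hl₁, hl₂⟩ := hI
  obtain ⟨⟨x, hx, hP'x⟩, hP'P⟩ := hP'
  have hxP' : x ∈ P'.chamber := hP'x ▸ mem_connectedComponentIn hx
  obtain ⟨l, hl, h_sorted⟩ := hw x hxP'
  have h_rotated : l ~r l₁ ++ l₂ := Cycle.coe_eq_coe.1 (hl.trans hlw.symm)
  obtain ⟨c, h_mem, h_sorted'⟩ := IsSortedList.exists_vadd_of_isRotated h_sorted h_rotated
  refine hP.exists_isOrderIdeal_of_mem_chamber (hP.vadd_mem_chamber (hP'P hxP') c)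
    fun i hi j hj => ((List.pairwise_append.1 h_sorted').2.2 i ?_ j ?_).le
  · exact (List.mem_append.1 (h_mem i)).resolve_right fun h => hl₂ i h hi
  · exact (List.mem_append.1 (h_mem j)).resolve_left fun h => hj (hl₁ j h)

end IsToricPosetOf
end ToricPoset

theorem proposition6p2 {V : Type*} [Finite V] (G : SimpleGraph V) (ω : AcyclicOrientation G)
    (P : ToricPoset V) (hP : P.IsToricPosetOf G ω) (I : Set V) :
    List.TFAE [
      P.IsToricFilter I,
      ∃ ω' ∈ ω.toricClass, ω'.IsOrderIdeal I,
      ∃ ω'' ∈ ω.toricClass, ω''.IsOrderFilter I,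
      ∃ P' : ToricPoset V, P'.IsTotalExtension P ∧
        ∃ w : Cycle V, P'.HasCyclicOrder w ∧ w.IsConsecutive I] := by
  tfae_have 1 → 2 := hP.exists_isOrderIdeal_of_isToricFilter
  tfae_have 2 → 1 := fun ⟨_, hω, hI⟩ => hP.isToricFilter_of_isOrderIdeal hω hI
  tfae_have 2 ↔ 3 := AcyclicOrientation.exists_isOrderIdeal_iff_exists_isOrderFilter
  tfae_have 2 → 4 := fun ⟨_, hω, hI⟩ => hP.exists_isTotalExtension_of_isOrderIdeal hω hI
  tfae_have 4 → 2 := fun ⟨_, hP', _, hw, hI⟩ =>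
    hP.exists_isOrderIdeal_of_isTotalExtension hP' hw hI
  tfae_finish
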